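/- **Definitions.** A proper $H^*$-algebra is a complex Banach $*$-algebra $\mathcal A$ whose norm comes from a Hilbert space inner product satisfying $\langle ab,c\rangle=\langle b,a^*c\rangle=\langle a,cb^*\rangle$ for all $a,b,c\in\mathcal A$, and in which $\mathcal A a=0$ or $a\mathcal A=0$ implies $a=0$. An element $a$ is positive ($a\ge 0$) if $\langle ax,x\rangle\ge 0$ for all $x\in\mathcal A$. The trace class is $\tau(\mathcal A)=\{ab: a,b\in\mathcal A\}$, and $tr$ is the linear functional on it with $tr(a^*a)=\|a\|^2$ for all $a\in\mathcal A$ (equivalently $tr(b^*a)=\langle a,b\rangle$). For $a\in\mathcal A$, $|a|$ is the unique positive square root of $a^*a$, and $\tau(a)=tr(|a|)$ for $a\in\tau(\mathcal A)$ is the trace-class norm. A semi-inner product $H^*$-module over $\mathcal A$ is a complex vector space $X$ with a right $\mathcal A$-module structure compatible with the complex scalars and a map $\langle\cdot,\cdot\rangle:X\times X\to\tau(\mathcal A)$ such that $\langle x,y+z\rangle=\langle x,y\rangle+\langle x,z\rangle$, $\langle x,ya\rangle=\langle x,y\rangle a$, $\langle x,y\rangle^*=\langle y,x\rangle$ and $\langle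 x,x\rangle\ge 0$ for all $x,y,z\in X$, $a\in\mathcal A$. For $x\in X$, $|x|$ is the positive square root of $\langle x,x\rangle$. For a probability vector $\overline p=(p_1,\dots,p_n)$ (that is, $p_i\ge0$ and $\sum_i p_i=1$) and $\overline x,\overline y\in X^n$ put $$G_{\overline p}(\overline x,\overline y)=\sum_{i=1}^n p_i\langle x_i,y_i\rangle-\Big\langle\sum_{i=1}^n p_ix_i,\sum_{i=1}^n p_iy_i\Big\rangle .$$ **Theorem 5.1.** Let $X$ be a semi-inner product $H^*$-module over a proper $H^*$-algebra $\mathcal A$, let $a,b\in X$, let $\overline p\in\mathbb R^n$ be a probability vector, and let $\overline x,\overline y\in X^n$ and $r,s\ge 0$ be such that $$\big\||x_i-a|\big\|\le r,\qquad \big\||y_i-b|\big\|\le s\qquad\text{for all } i\in\{1,\dots,n\}.$$ Then $G_{\overline p}(\overline x,\overline y)\in\tau(\mathcal A)$ and $$\big|\tau\big(G_{\overline p}(\overline x,\overline y)\big)\big|\le rs .$$ The constant $1$ in front of $rs$ is sharp: if $\langle e,e\rangle\ne0$ for some $e\in X$, then for all $a,b\in X$ and all $r,s>0$, every real $c$ such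 that $|\tau(G_{\overline p}(\overline x,\overline y))|\le c\,rs$ holds for all $n$, all probability vectors $\overline p\in\mathbb R^n$ and all $\overline x,\overline y\in X^n$ satisfying the above bounds has $c\ge 1$. -/

import Mathlib

namespace HStar

open scoped ComplexOrder

/-- The axioms of a proper `H*`-algebra on a complex Banach `*`-algebra `A` whose norm is the norm of
a Hilbert space (completeness and the compatibility of scalars with product and involution are
separate instance arguments where they matter).  Mathlib's inner product is conjugate-linear in
its first argument; the two identities are insensitive to this convention.  `proper` excludes
degenerate products such as the zero product; the version with `a * b = 0` for all `b` follows by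
applying the involution. -/
class IsProperHStarAlgebra (A : Type*) [NonUnitalNormedRing A] [InnerProductSpace ℂ A]
    [StarRing A] : Prop where
  inner_mul_left : ∀ a b c : A, inner ℂ (a * b) c = inner ℂ b (star a * c)
  inner_mul_right : ∀ a b c : A, inner ℂ (a * b) c = inner ℂ a (c * star b)
  proper : ∀ a : A, (∀ b : A, b * a = 0) → a = 0

section Algebra

variable {A : Type*} [NonUnitalNormedRing A] [InnerProductSpace ℂ A]

/-- `a` is positive: `⟨a x, x⟩` is a nonnegative real number for every `x`. -/
def IsPositive (a : A) : Prop := ∀ x : A, 0 ≤ inner ℂ (a * x) x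

/-- The trace class `τ(A) = {a b : a, b ∈ A}`. -/
def traceClass (A : Type*) [NonUnitalNormedRing A] : Set A := {c | ∃ a b : A, c = a * b}

open Classical in
/-- The positive square root of `a`: the positive `b` with `b * b = a` (and `0` if there is none). -/
noncomputable def sqrt (a : A) : A :=
  if h : ∃ b : A, IsPositive b ∧ b * b = a then h.choose else 0

variable [StarRing A]

/-- The absolute value `|a|`, the positive square root of `a* a`. -/
noncomputable def absVal (a : A) : A := sqrt (star a * a)

open Classical in
/-- The trace on the trace class: `tr (a b) = ⟨b, a*⟩` for the inner product that is linear in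
its first argument, that is `inner ℂ (star a) b` in Mathlib's convention; in particular
`tr (a* a) = ‖a‖ ^ 2`.  In a proper `H*`-algebra the value does not depend on the factorization.
The value outside the trace class is `0`. -/
noncomputable def tr (c : A) : ℂ :=
  if h : ∃ q : A × A, c = q.1 * q.2 then inner ℂ (star h.choose.1) h.choose.2 else 0

/-- The trace-class norm `τ(a) = tr |a|` (a nonnegative real number). -/
noncomputable def tau (a : A) : ℝ := (tr (absVal a)).re

end Algebra

/-- A semi-inner product `H*`-module structure on the complex vector space `X`: a right action of
`A` on `X`, compatible with the complex scalars, and a `τ(A)`-valued generalized semi-inner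
product `ip`. -/
structure SemiInnerProductModule (A X : Type*) [NonUnitalNormedRing A] [InnerProductSpace ℂ A]
    [StarRing A] [AddCommGroup X] [Module ℂ X] where
  /-- the right action `x a` -/
  act : X → A → X
  add_act : ∀ (x y : X) (a : A), act (x + y) a = act x a + act y a
  act_add : ∀ (x : X) (a b : A), act x (a + b) = act x a + act x b
  act_mul : ∀ (x : X) (a b : A), act x (a * b) = act (act x a) b
  smul_act : ∀ (c : ℂ) (x : X) (a : A), act (c • x) a = c • act x a
  act_smul : ∀ (c : ℂ) (x : X) (a : A), act x (c • a) = c • act x a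
  /-- the generalized semi-inner product `⟨x, y⟩` -/
  ip : X → X → A
  ip_mem : ∀ x y : X, ip x y ∈ traceClass A
  ip_add : ∀ x y z : X, ip x (y + z) = ip x y + ip x z
  ip_act : ∀ (x y : X) (a : A), ip x (act y a) = ip x y * a
  star_ip : ∀ x y : X, star (ip x y) = ip y x
  ip_self : ∀ x : X, IsPositive (ip x x)

namespace SemiInnerProductModule

variable {A X : Type*} [NonUnitalNormedRing A] [InnerProductSpace ℂ A] [StarRing A]
  [AddCommGroup X] [Module ℂ X]

/-- The absolute value `|x|` of a module element: the positive square root of `⟨x, x⟩`. -/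
noncomputable def absVal (M : SemiInnerProductModule A X) (x : X) : A := sqrt (M.ip x x)

/-- `G_p(x, y) = ∑ p_i ⟨x_i, y_i⟩ - ⟨∑ p_i x_i, ∑ p_i y_i⟩`. -/
noncomputable def G (M : SemiInnerProductModule A X) {n : ℕ} (p : Fin n → ℝ)
    (x y : Fin n → X) : A :=
  ∑ i, (p i : ℂ) • M.ip (x i) (y i) - M.ip (∑ i, (p i : ℂ) • x i) (∑ i, (p i : ℂ) • y i)

end SemiInnerProductModule

/-- `p` is a probability vector. -/
def IsProbVec {n : ℕ} (p : Fin n → ℝ) : Prop := (∀ i, 0 ≤ p i) ∧ ∑ i, p i = 1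

end HStar

/-!
Write `|c|` for the absolute value in the algebra and `|x|` for that in the module. The covariance
`G_p(x, y)` equals `∑ p_i ⟨x_i - x̄, y_i - ȳ⟩`, which is the generalized inner product of the
deviations `√p_i (x_i - x̄)` and `√p_i (y_i - ȳ)` in the module `X ^ n` (`G_eq_pi_ip`). The upper
bound is then the trace-class Cauchy–Schwarz inequality `τ(⟨x, y⟩) ≤ ‖|x|‖ ‖|y|‖`
(`abs_tau_ip_le`) in `X ^ n`, together with the variance identity
`∑ p_i ⟨x_i - x̄, x_i - x̄⟩ = ∑ p_i ⟨x_i - a, x_i - a⟩ - ⟨x̄ - a, x̄ - a⟩`, whose trace shows that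
the deviations of `x` have norm at most `r`, those of `y` at most `s`.
Sharpness is seen on the two points `a ± f`, `b ± g` with `f`
and `g` positive multiples of `e`: there the covariance is `⟨f, g⟩`, a positive multiple of
`⟨e, e⟩`.

The work lies in the trace class. It rests on the following facts about a proper `H*`-algebra `A`.

* Finitely many elements `k_i` admit a common sequence `u` with `k_i u → k_i`
  (`exists_tendsto_mul`). This gives that the involution is isometric (`norm_star_eq`) and that the
  trace of a finite sum of products does not depend on the factors (`sum_inner_star_eq_zero`).
* A bounded right-linear operator `S` with `‖S x‖² ≤ ∑ ‖k_i x‖²` is the left multiplication by the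
  limit of `S (u_n)` (`exists_mul_eq`). Applied to the square root, in the bounded operators on `A`,
  of the left multiplication by a positive element, it yields square roots inside `A`
  (`IsPositive.exists_sqrt`).
* If `‖c x‖ ≤ ‖k x‖` for all `x`, then `c = V k` for a right-linear contraction `V`
  (`exists_contraction`). This makes the trace class closed under addition
  (`add_mem_traceClass`) and provides the polar decomposition `|c| = V c` used in the Cauchy–Schwarz inequality.
-/

namespace HStar

open Filter Topology
open scoped ComplexOrder InnerProductSpace

section Algebra

variable {A : Type*} [NonUnitalNormedRing A] [InnerProductSpace ℂ A] [StarRing A]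
  [IsProperHStarAlgebra A]

/-! ### Multiplication, involution and inner product -/

theorem inner_mul_left (a b c : A) : ⟪a * b, c⟫_ℂ = ⟪b, star a * c⟫_ℂ :=
  IsProperHStarAlgebra.inner_mul_left a b c

theorem inner_mul_right (a b c : A) : ⟪a * b, c⟫_ℂ = ⟪a, c * star b⟫_ℂ :=
  IsProperHStarAlgebra.inner_mul_right a b c

theorem eq_of_forall_mul_right {a b : A} (h : ∀ x, a * x = b * x) : a = b := by
  rw [← sub_eq_zero, ← star_eq_zero]
  refine IsProperHStarAlgebra.proper _ fun x => ?_
  have : (a - b) * star x = 0 := by rw [sub_mul, h, sub_self]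
  simpa using congrArg star this

/-- The involution is anti-unitary as soon as one of the two vectors is a product. -/
theorem inner_mul_eq_inner_star (x y b : A) : ⟪x * y, b⟫_ℂ = ⟪star b, star (x * y)⟫_ℂ := by
  have h := inner_mul_right (star b) x (star y)
  rw [star_mul, inner_mul_right]
  have h2 := inner_mul_left b (star y) x
  have h3 := congrArg (starRingEnd ℂ) h2
  rw [inner_conj_symm, inner_conj_symm] at h3
  rw [h3, h]

theorem inner_star_mul_self_mul (a x : A) :
    ⟪star a * a * x, x⟫_ℂ = ((‖a * x‖ ^ 2 : ℝ) : ℂ) := by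
  rw [mul_assoc, inner_mul_left, star_star, inner_self_eq_norm_sq_to_K]
  norm_cast

theorem isPositive_star_mul_self (a : A) : IsPositive (star a * a) := fun x => by
  rw [inner_star_mul_self_mul]
  exact Complex.zero_le_real.2 (sq_nonneg _)

variable [CompleteSpace A] [SMulCommClass ℂ A A]

/-- Finitely many elements `k i` lie simultaneously in the closures of the right ideals `k i * A`:
the component of `(k i)` orthogonal to all `(k i * x)` is annihilated by right multiplication. -/
theorem exists_tendsto_mul {ι : Type*} [Fintype ι] (k : ι → A) :
    ∃ u : ℕ → A, ∀ i, Tendsto (fun n => k i * u n) atTop (𝓝 (k i)) := by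
  let K : A →ₗ[ℂ] PiLp 2 (fun _ : ι => A) :=
    { toFun := fun x => WithLp.toLp 2 fun i => k i * x
      map_add' := fun x y => by ext i; simp [mul_add]
      map_smul' := fun c x => by ext i; simp [mul_smul_comm] }
  let W := (LinearMap.range K).topologicalClosure
  have hW : ∀ q : PiLp 2 (fun _ : ι => A), q ∈ Wᗮ ↔ ∀ x, ∑ i, ⟪k i * x, q i⟫_ℂ = 0 := fun q => by
    rw [Submodule.orthogonal_closure, Submodule.mem_orthogonal]
    simp [K, PiLp.inner_apply]
  obtain ⟨p, hp, q, hq, hpq⟩ := W.exists_add_mem_mem_orthogonal (WithLp.toLp 2 k)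
  have hinv : ∀ w ∈ Wᗮ, ∀ u : A, WithLp.toLp 2 (fun i => w i * u) ∈ Wᗮ := fun w hw u => by
    rw [hW] at hw ⊢
    intro x
    rw [← hw (x * star u)]
    refine Finset.sum_congr rfl fun i _ => ?_
    have := inner_mul_right (w i) u (k i * x)
    rw [← inner_conj_symm, this, inner_conj_symm, mul_assoc]
  have hk : ∀ i, k i = p i + q i := fun i => by
    have := congrArg (fun w : PiLp 2 (fun _ : ι => A) => w i) hpq
    simpa using this
  -- `q u = k u - p u` is orthogonal to itself: it is orthogonal to `k u`, and `⟪p u, q u⟫` equals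
  -- `⟪p, q u u*⟫ = 0`.
  have hq0 : ∀ i u, q i * u = 0 := by
    intro i u
    have hqu := hinv q hq u
    have hquu := hinv _ hqu (star u)
    have h1 : ∑ j, ⟪k j * u, q j * u⟫_ℂ = 0 := (hW _).1 hqu u
    have h2 : ∑ j, ⟪p j * u, q j * u⟫_ℂ = 0 := by
      have := Submodule.inner_right_of_mem_orthogonal hp hquu
      rw [PiLp.inner_apply] at this
      rw [← this]
      exact Finset.sum_congr rfl fun j _ => inner_mul_right _ _ _
    have h3 : ∑ j, ((‖q j * u‖ ^ 2 : ℝ) : ℂ) = 0 := by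
      rw [← sub_eq_zero.2 (h1.trans h2.symm), ← Finset.sum_sub_distrib]
      refine Finset.sum_congr rfl fun j _ => ?_
      rw [← inner_sub_left, ← sub_mul, hk j, add_sub_cancel_left, inner_self_eq_norm_sq_to_K]
      simp
    rw [← Complex.ofReal_sum, Complex.ofReal_eq_zero,
      Finset.sum_eq_zero_iff_of_nonneg fun _ _ => by positivity] at h3
    simpa using h3 i (Finset.mem_univ i)
  have hkW : WithLp.toLp 2 k ∈ closure (LinearMap.range K : Set (PiLp 2 (fun _ : ι => A))) := by
    have hq' : q = 0 := by
      ext i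
      exact eq_of_forall_mul_right fun u => by simpa using hq0 i u
    rw [hpq, hq', add_zero]
    exact hp
  obtain ⟨v, hv, hvt⟩ := mem_closure_iff_seq_limit.1 hkW
  choose u hu using hv
  refine ⟨u, fun i => ?_⟩
  have := ((PiLp.continuous_apply 2 (fun _ : ι => A) i).tendsto _).comp hvt
  refine this.congr fun n => ?_
  simp [← hu, K]

/-- The bound follows from `⟪a* u, a*⟫ = ⟪a, (a* u)*⟫` and `‖(a* u)*‖ = ‖a* u‖`, letting
`a* u → a*`. -/
theorem norm_star_le (a : A) : ‖star a‖ ≤ ‖a‖ := by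
  obtain ⟨u, hu⟩ := exists_tendsto_mul (fun _ : Unit => star a)
  have hu := hu ()
  have hmul : ∀ x y : A, ‖star (x * y)‖ = ‖x * y‖ := fun x y => by
    have h := inner_mul_eq_inner_star x y (x * y)
    rw [inner_self_eq_norm_sq_to_K, inner_self_eq_norm_sq_to_K] at h
    have h2 : ‖x * y‖ ^ 2 = ‖star (x * y)‖ ^ 2 := by exact_mod_cast h
    exact ((sq_eq_sq₀ (norm_nonneg _) (norm_nonneg _)).1 h2).symm
  have hle : ∀ n, ‖⟪star a * u n, star a⟫_ℂ‖ ≤ ‖star a * u n‖ * ‖a‖ := fun n => by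
    rw [inner_mul_eq_inner_star, star_star, ← hmul, mul_comm]
    exact norm_inner_le_norm _ _
  have hlim := le_of_tendsto_of_tendsto' (hu.inner tendsto_const_nhds).norm
    (hu.norm.mul_const ‖a‖) hle
  rw [inner_self_eq_norm_sq_to_K] at hlim
  have hlim' : ‖star a‖ * ‖star a‖ ≤ ‖star a‖ * ‖a‖ := by simpa [sq] using hlim
  rcases (norm_nonneg (star a)).eq_or_lt with h | h
  · rw [← h]
    exact norm_nonneg a
  · exact le_of_mul_le_mul_left hlim' h

theorem norm_star_eq (a : A) : ‖star a‖ = ‖a‖ :=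
  le_antisymm (norm_star_le a) (by simpa using norm_star_le (star a))

theorem tendsto_star {u : ℕ → A} {a : A} (h : Tendsto u atTop (𝓝 a)) :
    Tendsto (fun n => star (u n)) atTop (𝓝 (star a)) := by
  rw [tendsto_iff_norm_sub_tendsto_zero] at h ⊢
  refine h.congr fun n => ?_
  rw [← star_sub, norm_star_eq]

/-- Left-handed version of `exists_tendsto_mul`. -/
theorem exists_tendsto_mul_left {ι : Type*} [Fintype ι] (k : ι → A) :
    ∃ u : ℕ → A, ∀ i, Tendsto (fun n => u n * k i) atTop (𝓝 (k i)) := by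
  obtain ⟨u, hu⟩ := exists_tendsto_mul fun i => star (k i)
  exact ⟨fun n => star (u n), fun i => by simpa using tendsto_star (hu i)⟩

/-! ### The trace -/

/-- The trace of a finite sum of products is well defined: `⟪aᵢ* u, bᵢ⟫ = ⟪u, aᵢ bᵢ⟫`, and `u` can
run through a sequence with `aᵢ* u → aᵢ*` for all `i`. -/
theorem sum_inner_star_eq_zero {ι : Type*} [Fintype ι] (a b : ι → A)
    (h : ∑ i, a i * b i = 0) : ∑ i, ⟪star (a i), b i⟫_ℂ = 0 := by
  obtain ⟨u, hu⟩ := exists_tendsto_mul fun i => star (a i)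
  have h1 : Tendsto (fun n => ∑ i, ⟪star (a i) * u n, b i⟫_ℂ) atTop
      (𝓝 (∑ i, ⟪star (a i), b i⟫_ℂ)) :=
    tendsto_finsetSum _ fun i _ => (hu i).inner tendsto_const_nhds
  refine tendsto_nhds_unique h1 (tendsto_const_nhds.congr fun n => ?_)
  simp_rw [inner_mul_left, star_star]
  rw [← inner_sum, h, inner_zero_right]

theorem tr_mul (a b : A) : tr (a * b) = ⟪star a, b⟫_ℂ := by
  have hex : ∃ q : A × A, a * b = q.1 * q.2 := ⟨(a, b), rfl⟩
  rw [tr, dif_pos hex]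
  have := sum_inner_star_eq_zero ![a, -hex.choose.1] ![b, hex.choose.2]
    (by simpa [sub_eq_zero, ← sub_eq_add_neg] using hex.choose_spec)
  simp only [Fin.sum_univ_two, Matrix.cons_val_zero, Matrix.cons_val_one, star_neg,
    inner_neg_left, ← sub_eq_add_neg, sub_eq_zero] at this
  exact this.symm

theorem tr_add {c d : A} (hc : c ∈ traceClass A) (hd : d ∈ traceClass A)
    (hcd : c + d ∈ traceClass A) : tr (c + d) = tr c + tr d := by
  obtain ⟨a, b, rfl⟩ := hc
  obtain ⟨a', b', rfl⟩ := hd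
  obtain ⟨a'', b'', h⟩ := hcd
  rw [h, tr_mul, tr_mul, tr_mul]
  have := sum_inner_star_eq_zero ![a, a', -a''] ![b, b', b'']
    (by simp [Fin.sum_univ_three, h])
  simp only [Fin.sum_univ_three, Matrix.cons_val_zero, Matrix.cons_val_one, Matrix.cons_val,
    star_neg, inner_neg_left] at this
  linear_combination -this

theorem tr_smul (z : ℂ) {c : A} (hc : c ∈ traceClass A) : tr (z • c) = z * tr c := by
  obtain ⟨a, b, rfl⟩ := hc
  rw [← mul_smul_comm, tr_mul, tr_mul, inner_smul_right]

theorem tr_star {c : A} (hc : c ∈ traceClass A) : tr (star c) = starRingEnd ℂ (tr c) := by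
  obtain ⟨a, b, rfl⟩ := hc
  rw [star_mul, tr_mul, tr_mul, star_star, inner_conj_symm]

theorem smul_mem_traceClass {A : Type*} [NonUnitalNormedRing A] [Module ℂ A]
    [SMulCommClass ℂ A A] (z : ℂ) {c : A} (hc : c ∈ traceClass A) : z • c ∈ traceClass A := by
  obtain ⟨a, b, rfl⟩ := hc
  exact ⟨a, z • b, (mul_smul_comm _ _ _).symm⟩

end Algebra

section Positive

variable {A : Type*} [NonUnitalNormedRing A] [InnerProductSpace ℂ A] [StarRing A]
  [IsProperHStarAlgebra A] [SMulCommClass ℂ A A]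

/-! ### Positive elements as positive operators -/

section

variable [IsScalarTower ℂ A A]

theorem isPositive_iff_nonneg {A : Type*} [NonUnitalNormedRing A] [InnerProductSpace ℂ A]
    [IsScalarTower ℂ A A] [SMulCommClass ℂ A A] {a : A} :
    IsPositive a ↔ 0 ≤ ContinuousLinearMap.mul ℂ A a := by
  rw [ContinuousLinearMap.nonneg_iff_isPositive, ContinuousLinearMap.isPositive_iff_complex]
  refine forall_congr' fun x => ?_
  rw [Complex.nonneg_iff]
  simp only [ContinuousLinearMap.mul_apply', Complex.ext_iff]
  simp
  tauto

theorem IsPositive.star_eq {a : A} (ha : IsPositive a) : star a = a := by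
  have hsymm := ((ContinuousLinearMap.nonneg_iff_isPositive _).1
    (isPositive_iff_nonneg.1 ha)).isSymmetric
  refine eq_of_forall_mul_right fun x => ext_inner_left ℂ fun y => ?_
  rw [← inner_mul_left]
  exact hsymm y x

end

variable [CompleteSpace A]

/-! ### Right-linear operators -/

/-- A bounded operator commuting with right multiplications and dominated by left multiplication by
finitely many elements is itself a left multiplication: if `k i * u n → k i`, then `S (u n)`
converges to the required element. -/
theorem exists_mul_eq {ι : Type*} [Fintype ι] (k : ι → A) (S : A →L[ℂ] A)
    (hS : ∀ x y, S (x * y) = S x * y) (hk : ∀ x, ‖S x‖ ^ 2 ≤ ∑ i, ‖k i * x‖ ^ 2) :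
    ∃ h : A, ∀ x, h * x = S x := by
  obtain ⟨u, hu⟩ := exists_tendsto_mul k
  let Φ : A → PiLp 2 (fun _ : ι => A) := fun x => WithLp.toLp 2 fun i => k i * x
  have hΦ : ∀ x y, ‖S x - S y‖ ≤ ‖Φ x - Φ y‖ := fun x y => by
    rw [← sq_le_sq₀ (norm_nonneg _) (norm_nonneg _), ← map_sub, PiLp.norm_sq_eq_of_L2]
    simpa [Φ, mul_sub] using hk (x - y)
  have hlim : ∀ y, Tendsto (fun n => Φ (u n * y)) atTop (𝓝 (Φ y)) := fun y => by
    refine ((PiLp.continuous_toLp 2 (fun _ : ι => A)).tendsto _).comp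
      (tendsto_pi_nhds.2 fun i => ?_)
    simpa [mul_assoc] using (hu i).mul_const y
  have hlim1 : Tendsto (fun n => Φ (u n)) atTop (𝓝 (WithLp.toLp 2 k)) :=
    ((PiLp.continuous_toLp 2 (fun _ : ι => A)).tendsto _).comp (tendsto_pi_nhds.2 hu)
  have hcau : CauchySeq fun n => S (u n) := by
    rw [Metric.cauchySeq_iff']
    intro ε hε
    obtain ⟨N, hN⟩ := Metric.cauchySeq_iff'.1 hlim1.cauchySeq ε hε
    refine ⟨N, fun n hn => lt_of_le_of_lt ?_ (hN n hn)⟩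
    rw [dist_eq_norm, dist_eq_norm]
    exact hΦ _ _
  obtain ⟨h, hh⟩ := cauchySeq_tendsto_of_complete hcau
  refine ⟨h, fun y => tendsto_nhds_unique (hh.mul_const y) ?_⟩
  rw [tendsto_iff_norm_sub_tendsto_zero]
  refine squeeze_zero (fun _ => norm_nonneg _) (fun n => ?_)
    (tendsto_iff_norm_sub_tendsto_zero.1 (hlim y))
  rw [← hS]
  exact hΦ _ _

/-! ### Square roots -/

variable [IsScalarTower ℂ A A]

theorem IsPositive.ext {a b : A} (ha : IsPositive a) (hb : IsPositive b) (h : a * a = b * b) :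
    a = b := by
  have hmul : ContinuousLinearMap.mul ℂ A a = ContinuousLinearMap.mul ℂ A b := by
    rw [← CFC.mul_self_eq_mul_self_iff _ _ (isPositive_iff_nonneg.1 ha)
      (isPositive_iff_nonneg.1 hb)]
    ext x
    simp only [mul_apply_eq_comp, ContinuousLinearMap.mul_apply', ← mul_assoc, h]
  refine eq_of_forall_mul_right fun x => ?_
  simpa using DFunLike.congr_fun hmul x

/-- A positive element whose quadratic form is dominated by that of a finite sum `∑ kᵢ* kᵢ` has a
positive square root in the algebra: the operator square root is a left multiplication. -/
theorem IsPositive.exists_sqrt {ι : Type*} [Fintype ι] {c : A} (hc : IsPositive c) (k : ι → A)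
    (hk : ∀ x, (⟪c * x, x⟫_ℂ).re ≤ ∑ i, ‖k i * x‖ ^ 2) :
    ∃ h : A, IsPositive h ∧ h * h = c := by
  set T := ContinuousLinearMap.mul ℂ A c with hT
  have hT0 : 0 ≤ T := isPositive_iff_nonneg.1 hc
  set S := CFC.sqrt T with hSdef
  have hSS : S * S = T := CFC.sqrt_mul_sqrt_self T hT0
  have hS0 : 0 ≤ S := CFC.sqrt_nonneg T
  have hSmul : ∀ x y, S (x * y) = S x * y := fun x y => by
    -- `T` commutes with right multiplication by `y`, hence so does its square root.
    have hcomm : Commute T ((ContinuousLinearMap.mul ℂ A).flip y) := by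
      ext z
      simp [hT, mul_assoc]
    exact DFunLike.congr_fun (hcomm.cfcₙ_nnreal NNReal.sqrt).eq x
  have hnorm : ∀ x, ‖S x‖ ^ 2 = (⟪c * x, x⟫_ℂ).re := fun x => by
    have h1 : S (S x) = c * x := DFunLike.congr_fun hSS x
    rw [← h1, (ContinuousLinearMap.nonneg_iff_isPositive _).1 hS0 |>.inner_left_eq_inner_right,
      inner_self_eq_norm_sq_to_K]
    norm_cast
  obtain ⟨h, hh⟩ := exists_mul_eq k S hSmul fun x => (hnorm x).trans_le (hk x)
  have hmul : ContinuousLinearMap.mul ℂ A h = S := by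
    ext x
    exact hh x
  refine ⟨h, isPositive_iff_nonneg.2 (hmul ▸ hS0), eq_of_forall_mul_right fun x => ?_⟩
  rw [mul_assoc, hh, hh]
  exact DFunLike.congr_fun hSS x

/-- The quadratic form of `a * b` is dominated by that of `a a* + b* b`. -/
theorem IsPositive.exists_sqrt_of_mem {c : A} (hc : IsPositive c) (hmem : c ∈ traceClass A) :
    ∃ h : A, IsPositive h ∧ h * h = c := by
  obtain ⟨a, b, rfl⟩ := hmem
  refine hc.exists_sqrt ![star a, b] fun x => ?_
  have h1 : (⟪a * b * x, x⟫_ℂ).re ≤ ‖b * x‖ * ‖star a * x‖ := by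
    rw [mul_assoc, inner_mul_left]
    exact (Complex.re_le_norm _).trans (norm_inner_le_norm _ _)
  simp only [Fin.sum_univ_two, Matrix.cons_val_zero, Matrix.cons_val_one]
  nlinarith [sq_nonneg (‖b * x‖ - ‖star a * x‖), sq_nonneg (‖b * x‖), sq_nonneg ‖star a * x‖]

theorem sqrt_spec {c : A} (hc : IsPositive c) (hmem : c ∈ traceClass A) :
    IsPositive (sqrt c) ∧ sqrt c * sqrt c = c := by
  have h := hc.exists_sqrt_of_mem hmem
  rw [sqrt, dif_pos h]
  exact h.choose_spec

theorem absVal_spec (a : A) : IsPositive (absVal a) ∧ absVal a * absVal a = star a * a :=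
  sqrt_spec (isPositive_star_mul_self a) ⟨_, _, rfl⟩

theorem norm_sqrt_sq {c : A} (hc : IsPositive c) (hmem : c ∈ traceClass A) :
    ‖sqrt c‖ ^ 2 = (tr c).re := by
  obtain ⟨h1, h2⟩ := sqrt_spec hc hmem
  rw [← h2, tr_mul, h1.star_eq, inner_self_eq_norm_sq_to_K, h2]
  norm_cast

theorem absVal_of_isPositive {a : A} (ha : IsPositive a) : absVal a = a :=
  (absVal_spec a).1.ext ha (by rw [(absVal_spec a).2, ha.star_eq])

/-! ### Factorization and sums of trace class elements -/

/-- Douglas factorization. The contraction `V` is the extension by continuity of `k * x ↦ c * x`,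
and vanishes on the orthogonal complement of `k * A`; this choice makes it commute with right
multiplications. -/
theorem exists_contraction (c k : A) (h : ∀ x, ‖c * x‖ ≤ ‖k * x‖) :
    ∃ V : A →L[ℂ] A, (∀ x, ‖V x‖ ≤ ‖x‖) ∧ (∀ x y, V (x * y) = V x * y) ∧ V k = c := by
  let K : A →ₗ[ℂ] A := (ContinuousLinearMap.mul ℂ A k).toLinearMap
  let F : A →ₗ[ℂ] A := (ContinuousLinearMap.mul ℂ A c).toLinearMap
  let W := (LinearMap.range K).topologicalClosure
  let e : A →ₗ[ℂ] W := K.codRestrict W fun x =>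
    Submodule.le_topologicalClosure _ (LinearMap.mem_range_self K x)
  have he : DenseRange e := by
    intro w
    rw [Metric.mem_closure_range_iff]
    intro ε hε
    obtain ⟨_, ⟨x, rfl⟩, hx⟩ := Metric.mem_closure_iff.1 w.2 ε hε
    exact ⟨x, hx⟩
  have hFe : ∀ x, ‖F x‖ ≤ 1 * ‖e x‖ := fun x => by
    rw [one_mul]
    exact h x
  let V : A →L[ℂ] A := (F.extendOfNorm e).comp W.orthogonalProjectionOnto
  have hVk : ∀ x, V (k * x) = c * x := fun x => by
    have : W.orthogonalProjectionOnto (k * x) = e x :=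
      W.orthogonalProjectionOnto_mem_subspace_eq_self (e x)
    change F.extendOfNorm e (W.orthogonalProjectionOnto (k * x)) = _
    rw [this, LinearMap.extendOfNorm_eq he ⟨1, hFe⟩]
    rfl
  have hVperp : ∀ x ∈ Wᗮ, V x = 0 := fun x hx => by
    change F.extendOfNorm e (W.orthogonalProjectionOnto x) = 0
    rw [Submodule.orthogonalProjectionOnto_apply_of_mem_orthogonal hx, map_zero]
  have hVmul : ∀ x y, V (x * y) = V x * y := by
    intro x y
    obtain ⟨p, hp, q, hq, rfl⟩ := W.exists_add_mem_mem_orthogonal x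
    have hpy : V (p * y) = V p * y := by
      have hcl : IsClosed {p : A | V (p * y) = V p * y} :=
        isClosed_eq (by fun_prop) (by fun_prop)
      refine closure_minimal ?_ hcl hp
      rintro _ ⟨z, rfl⟩
      change V (k * z * y) = V (k * z) * y
      rw [mul_assoc, hVk, hVk, mul_assoc]
    have hqy : q * y ∈ Wᗮ := by
      rw [Submodule.orthogonal_closure, Submodule.mem_orthogonal] at hq ⊢
      rintro _ ⟨z, rfl⟩
      rw [← hq _ (LinearMap.mem_range_self K (z * star y)), ← inner_conj_symm, inner_mul_right,
        inner_conj_symm]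
      simp [K, mul_assoc]
    rw [add_mul, map_add, map_add, hVperp _ hqy, hVperp _ hq, hpy, add_zero, add_zero]
  refine ⟨V, fun x => ?_, hVmul, eq_of_forall_mul_right fun x => by rw [← hVmul, hVk]⟩
  refine (LinearMap.norm_extendOfNorm_apply_le he 1 hFe _).trans ?_
  rw [one_mul]
  exact W.norm_orthogonalProjectionOnto_apply_le x

theorem norm_absVal_mul (c x : A) : ‖absVal c * x‖ = ‖c * x‖ := by
  obtain ⟨h1, h2⟩ := absVal_spec c
  have h := inner_star_mul_self_mul (absVal c) x
  rw [h1.star_eq, h2, inner_star_mul_self_mul] at h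
  exact ((sq_eq_sq₀ (norm_nonneg _) (norm_nonneg _)).1 (Complex.ofReal_injective h)).symm

/-- With `k = (b₁* b₁ + b₂* b₂)^{1/2}` there are contractions with `bᵢ = Vᵢ k`, hence
`a₁ b₁ + a₂ b₂ = (V₁† a₁* + V₂† a₂*)* k`. -/
theorem add_mem_traceClass {c d : A} (hc : c ∈ traceClass A) (hd : d ∈ traceClass A) :
    c + d ∈ traceClass A := by
  obtain ⟨a₁, b₁, rfl⟩ := hc
  obtain ⟨a₂, b₂, rfl⟩ := hd
  have hform : ∀ x, ⟪(star b₁ * b₁ + star b₂ * b₂) * x, x⟫_ℂ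
      = ((‖b₁ * x‖ ^ 2 + ‖b₂ * x‖ ^ 2 : ℝ) : ℂ) := fun x => by
    rw [add_mul, inner_add_left, inner_star_mul_self_mul, inner_star_mul_self_mul,
      Complex.ofReal_add]
  have hpos : IsPositive (star b₁ * b₁ + star b₂ * b₂) := fun x => by
    rw [hform]
    exact Complex.zero_le_real.2 (by positivity)
  obtain ⟨k, hk, hkk⟩ := hpos.exists_sqrt ![b₁, b₂] fun x => by
    rw [hform, Complex.ofReal_re]
    simp
  have hkx : ∀ x, ‖k * x‖ ^ 2 = ‖b₁ * x‖ ^ 2 + ‖b₂ * x‖ ^ 2 := fun x => by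
    have h := hform x
    have h2 := inner_star_mul_self_mul k x
    rw [hk.star_eq, hkk, h] at h2
    exact (Complex.ofReal_injective h2).symm
  obtain ⟨V₁, -, hV₁, hVk₁⟩ := exists_contraction b₁ k fun x => by
    rw [← sq_le_sq₀ (norm_nonneg _) (norm_nonneg _), hkx]
    exact le_add_of_nonneg_right (sq_nonneg _)
  obtain ⟨V₂, -, hV₂, hVk₂⟩ := exists_contraction b₂ k fun x => by
    rw [← sq_le_sq₀ (norm_nonneg _) (norm_nonneg _), hkx]
    exact le_add_of_nonneg_left (sq_nonneg _)
  set w := ContinuousLinearMap.adjoint V₁ (star a₁) + ContinuousLinearMap.adjoint V₂ (star a₂)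
  have hw : k * w = star (a₁ * b₁ + a₂ * b₂) := ext_inner_right ℂ fun x => by
    rw [inner_mul_left, hk.star_eq, inner_add_left, ContinuousLinearMap.adjoint_inner_left,
      ContinuousLinearMap.adjoint_inner_left, hV₁, hV₂, hVk₁, hVk₂, star_add, inner_add_left,
      star_mul, star_mul, inner_mul_left, inner_mul_left, star_star, star_star]
  refine ⟨star w, k, ?_⟩
  rw [← star_star (a₁ * b₁ + a₂ * b₂), ← hw, star_mul, hk.star_eq]

theorem sum_mem_traceClass {ι : Type*} (s : Finset ι) (f : ι → A)
    (h : ∀ i ∈ s, f i ∈ traceClass A) : ∑ i ∈ s, f i ∈ traceClass A :=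
  Finset.sum_induction f (· ∈ traceClass A) (fun _ _ => add_mem_traceClass)
    ⟨0, 0, (mul_zero 0).symm⟩ h

theorem tr_sum {ι : Type*} (s : Finset ι) (f : ι → A) (h : ∀ i ∈ s, f i ∈ traceClass A) :
    tr (∑ i ∈ s, f i) = ∑ i ∈ s, tr (f i) := by
  classical
  induction s using Finset.induction_on with
  | empty => simpa using tr_mul (0 : A) 0
  | insert i s hi ih =>
    have hs : ∀ j ∈ s, f j ∈ traceClass A := fun j hj => h j (Finset.mem_insert_of_mem hj)
    have hi' := h i (Finset.mem_insert_self i s)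
    have hs' := sum_mem_traceClass s f hs
    rw [Finset.sum_insert hi, Finset.sum_insert hi, tr_add hi' hs' (add_mem_traceClass hi' hs'),
      ih hs]

end Positive

namespace SemiInnerProductModule

/-! ### Linearity of the generalized semi-inner product -/

variable {A X : Type*} [NonUnitalNormedRing A] [InnerProductSpace ℂ A] [StarRing A]
  [AddCommGroup X] [Module ℂ X] (M : SemiInnerProductModule A X)

theorem add_ip (x y z : X) : M.ip (x + y) z = M.ip x z + M.ip y z := by
  rw [← M.star_ip, M.ip_add, star_add, M.star_ip, M.star_ip]

theorem act_ip (x y : X) (a : A) : M.ip (M.act x a) y = star a * M.ip x y := by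
  rw [← M.star_ip, M.ip_act, star_mul, M.star_ip]

theorem ip_sum {ι : Type*} (s : Finset ι) (x : X) (f : ι → X) :
    M.ip x (∑ i ∈ s, f i) = ∑ i ∈ s, M.ip x (f i) :=
  map_sum (AddMonoidHom.mk' (M.ip x) (M.ip_add x)) f s

theorem sum_ip {ι : Type*} (s : Finset ι) (f : ι → X) (y : X) :
    M.ip (∑ i ∈ s, f i) y = ∑ i ∈ s, M.ip (f i) y :=
  map_sum (AddMonoidHom.mk' (M.ip · y) fun _ _ => M.add_ip _ _ y) f s

theorem ip_sub (x y z : X) : M.ip x (y - z) = M.ip x y - M.ip x z :=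
  map_sub (AddMonoidHom.mk' (M.ip x) (M.ip_add x)) y z

theorem sub_ip (x y z : X) : M.ip (x - y) z = M.ip x z - M.ip y z :=
  map_sub (AddMonoidHom.mk' (M.ip · z) fun _ _ => M.add_ip _ _ z) x y

variable [IsProperHStarAlgebra A] [SMulCommClass ℂ A A] [IsScalarTower ℂ A A]

/-- Homogeneity is not an axiom; it follows from the compatibility of the action with the
scalars, since `c • y` and `y` satisfy `(c • y) a = y (c • a)`. -/
theorem ip_smul (c : ℂ) (x y : X) : M.ip x (c • y) = c • M.ip x y := by
  refine eq_of_forall_mul_right fun a => ?_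
  rw [← M.ip_act, M.smul_act, ← M.act_smul, M.ip_act, mul_smul_comm, smul_mul_assoc]

section Complete

/-! ### The absolute value on a module, and finite powers of a module -/

variable [CompleteSpace A]

theorem norm_absVal_sq (x : X) : ‖M.absVal x‖ ^ 2 = (tr (M.ip x x)).re :=
  norm_sqrt_sq (M.ip_self x) (M.ip_mem x x)

theorem norm_absVal_pos {e : X} (he : M.ip e e ≠ 0) : 0 < ‖M.absVal e‖ := by
  rw [norm_pos_iff]
  intro h
  have := (sqrt_spec (M.ip_self e) (M.ip_mem e e)).2
  rw [absVal] at h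
  rw [h, mul_zero] at this
  exact he this.symm

theorem tau_ip_self (x : X) : tau (M.ip x x) = ‖M.absVal x‖ ^ 2 := by
  rw [tau, absVal_of_isPositive (M.ip_self x), norm_absVal_sq]

/-- The module `X ^ ι` with the coordinatewise action and `⟨x, y⟩ = ∑ i, ⟨x i, y i⟩`. -/
def pi (ι : Type*) [Fintype ι] : SemiInnerProductModule A (ι → X) where
  act x a i := M.act (x i) a
  add_act _ _ _ := funext fun _ => M.add_act _ _ _
  act_add _ _ _ := funext fun _ => M.act_add _ _ _
  act_mul _ _ _ := funext fun _ => M.act_mul _ _ _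
  smul_act _ _ _ := funext fun _ => M.smul_act _ _ _
  act_smul _ _ _ := funext fun _ => M.act_smul _ _ _
  ip x y := ∑ i, M.ip (x i) (y i)
  ip_mem _ _ := sum_mem_traceClass _ _ fun _ _ => M.ip_mem _ _
  ip_add x y z := by simp [M.ip_add, Finset.sum_add_distrib]
  ip_act x y a := by simp [M.ip_act, Finset.sum_mul]
  star_ip x y := by simp [M.star_ip]
  ip_self x z := by
    rw [Finset.sum_mul, sum_inner]
    exact Finset.sum_nonneg fun i _ => M.ip_self (x i) z

theorem pi_ip {ι : Type*} [Fintype ι] (x y : ι → X) :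
    (M.pi ι).ip x y = ∑ i, M.ip (x i) (y i) := rfl

end Complete

/-! ### Homogeneity in the first variable and the variance identity -/

variable [StarModule ℂ A]

theorem smul_ip (c : ℂ) (x y : X) : M.ip (c • x) y = (starRingEnd ℂ c) • M.ip x y := by
  rw [← M.star_ip, M.ip_smul, star_smul, M.star_ip]
  rfl

theorem ofReal_smul_ip (t : ℝ) (x y : X) : M.ip ((t : ℂ) • x) y = (t : ℂ) • M.ip x y := by
  rw [M.smul_ip, Complex.conj_ofReal]

/-- The variance identity: the centred covariance may be computed with any two centres. -/
theorem sum_smul_ip_sub_mean {n : ℕ} {p : Fin n → ℝ} (hp : ∑ i, p i = 1) (x y : Fin n → X)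
    (a b : X) :
    ∑ i, (p i : ℂ) • M.ip (x i - ∑ j, (p j : ℂ) • x j) (y i - ∑ j, (p j : ℂ) • y j) =
      ∑ i, (p i : ℂ) • M.ip (x i - a) (y i - b)
        - M.ip (∑ j, (p j : ℂ) • x j - a) (∑ j, (p j : ℂ) • y j - b) := by
  have hp' : ∑ i, (p i : ℂ) = 1 := by exact_mod_cast hp
  have hl : ∀ z, ∑ i, (p i : ℂ) • M.ip (x i) z = M.ip (∑ j, (p j : ℂ) • x j) z := fun z => by
    simp_rw [sum_ip, ofReal_smul_ip]
  have hr : ∀ z, ∑ i, (p i : ℂ) • M.ip z (y i) = M.ip z (∑ j, (p j : ℂ) • y j) := fun z => by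
    simp_rw [ip_sum, ip_smul]
  simp only [sub_ip, ip_sub, smul_sub, Finset.sum_sub_distrib, hl, hr, ← Finset.sum_smul, hp',
    one_smul]
  abel

theorem G_eq_sum_sub {n : ℕ} {p : Fin n → ℝ} (hp : ∑ i, p i = 1) (x y : Fin n → X) (a b : X) :
    M.G p x y = ∑ i, (p i : ℂ) • M.ip (x i - a) (y i - b)
        - M.ip (∑ j, (p j : ℂ) • x j - a) (∑ j, (p j : ℂ) • y j - b) := by
  rw [← M.sum_smul_ip_sub_mean hp, M.sum_smul_ip_sub_mean hp x y 0 0]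
  simp [G]

/-- Two points symmetric about each centre, with equal weights, have covariance `⟨f, g⟩`. -/
theorem G_two_point (a b f g : X) :
    M.G ![1 / 2, 1 / 2] ![a + f, a - f] ![b + g, b - g] = M.ip f g := by
  have hmean : ∀ a f : X, ∑ j, ((![1 / 2, 1 / 2] j : ℝ) : ℂ) • ![a + f, a - f] j = a :=
    fun a f => by
      simp only [Fin.sum_univ_two, Matrix.cons_val_zero, Matrix.cons_val_one]
      rw [← smul_add, add_add_sub_cancel, ← two_smul ℂ a, smul_smul]
      norm_num
  rw [M.G_eq_sum_sub (by norm_num [Fin.sum_univ_two]) _ _ a b, hmean, hmean]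
  have h0 : M.ip (0 : X) 0 = 0 := by simpa using M.ip_sub 0 0 0
  have hneg : M.ip (-f) (-g) = M.ip f g := by
    rw [← neg_one_smul ℂ f, ← neg_one_smul ℂ g, smul_ip, ip_smul, smul_smul]
    simp
  simp only [Fin.sum_univ_two, Matrix.cons_val_zero, Matrix.cons_val_one, add_sub_cancel_left,
    sub_sub_cancel_left, sub_self, h0, hneg, sub_zero]
  rw [← add_smul]
  norm_num

/-! ### Cauchy–Schwarz inequalities -/

variable [CompleteSpace A]

/-- The scalar semi-inner product `tr ⟨x, y⟩` on the module. -/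
noncomputable abbrev trCore : PreInnerProductSpace.Core ℂ X where
  inner x y := tr (M.ip x y)
  conj_inner_symm x y := by
    change starRingEnd ℂ (tr (M.ip y x)) = tr (M.ip x y)
    rw [← tr_star (M.ip_mem y x), M.star_ip]
  re_inner_nonneg x := by
    change 0 ≤ (tr (M.ip x x)).re
    rw [← M.norm_absVal_sq]
    positivity
  add_left x y z := by
    change tr (M.ip (x + y) z) = tr (M.ip x z) + tr (M.ip y z)
    rw [M.add_ip, tr_add (M.ip_mem x z) (M.ip_mem y z) (by rw [← M.add_ip]; exact M.ip_mem _ _)]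
  smul_left x y c := by
    change tr (M.ip (c • x) y) = starRingEnd ℂ c * tr (M.ip x y)
    rw [M.smul_ip, tr_smul _ (M.ip_mem x y)]

theorem norm_absVal_smul (t : ℝ) (x : X) : ‖M.absVal ((t : ℂ) • x)‖ = |t| * ‖M.absVal x‖ := by
  rw [← sq_eq_sq₀ (norm_nonneg _) (by positivity), mul_pow, sq_abs, norm_absVal_sq,
    norm_absVal_sq, M.ofReal_smul_ip, M.ip_smul, smul_smul, tr_smul _ (M.ip_mem x x),
    ← Complex.ofReal_mul, Complex.re_ofReal_mul, sq]

theorem norm_tr_ip_le (x y : X) : ‖tr (M.ip x y)‖ ≤ ‖M.absVal x‖ * ‖M.absVal y‖ := by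
  have h := @InnerProductSpace.Core.inner_mul_inner_self_le ℂ X _ _ _ M.trCore x y
  have hs : ‖tr (M.ip y x)‖ = ‖tr (M.ip x y)‖ := by
    rw [← M.star_ip x y, tr_star (M.ip_mem x y), RCLike.norm_conj]
  change ‖tr (M.ip x y)‖ * ‖tr (M.ip y x)‖ ≤ (tr (M.ip x x)).re * (tr (M.ip y y)).re at h
  rw [hs, ← norm_absVal_sq, ← norm_absVal_sq, ← sq, ← mul_pow] at h
  exact (sq_le_sq₀ (norm_nonneg _) (by positivity)).1 h

theorem norm_tr_mul_ip_le (v : A) (x y : X) :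
    ‖tr (v * M.ip x y)‖ ≤ ‖v * M.absVal x‖ * ‖M.absVal y‖ := by
  have h := M.norm_tr_ip_le (M.act x (star v)) y
  rw [M.act_ip, star_star] at h
  have hk := sqrt_spec (M.ip_self x) (M.ip_mem x x)
  have hv : ‖M.absVal (M.act x (star v))‖ = ‖v * M.absVal x‖ := by
    have hip : M.ip (M.act x (star v)) (M.act x (star v))
        = (v * M.absVal x) * star (v * M.absVal x) := by
      rw [M.ip_act, M.act_ip, star_star, star_mul, absVal, hk.1.star_eq, ← mul_assoc,
        mul_assoc v _ (sqrt _), hk.2, mul_assoc]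
    rw [← sq_eq_sq₀ (norm_nonneg _) (norm_nonneg _), norm_absVal_sq, hip, tr_mul,
      inner_self_eq_norm_sq_to_K, norm_star_eq]
    norm_cast
  rwa [hv] at h

/-- The trace-class Cauchy–Schwarz inequality. If `c = ⟨x, y⟩ = a * b` and `|c| = V c` with `V` a
right-linear contraction, then `tr |c|` is the limit of `tr (V u * c) = tr ⟨x (V u)*, y⟩` along `u`
with `u * |x| → |x|` and `u * a → a`. -/
theorem abs_tau_ip_le (x y : X) : |tau (M.ip x y)| ≤ ‖M.absVal x‖ * ‖M.absVal y‖ := by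
  obtain ⟨a, b, hab⟩ := M.ip_mem x y
  obtain ⟨V, hV1, hVmul, hVc⟩ := exists_contraction (HStar.absVal (M.ip x y)) (M.ip x y)
    fun z => (norm_absVal_mul _ z).le
  obtain ⟨u, hu⟩ := exists_tendsto_mul_left ![M.absVal x, a]
  have hux : Tendsto (fun n => u n * M.absVal x) atTop (𝓝 (M.absVal x)) := hu 0
  have hua : Tendsto (fun n => u n * a) atTop (𝓝 a) := hu 1
  have htr : Tendsto (fun n => tr (V (u n) * M.ip x y)) atTop
      (𝓝 (tr (HStar.absVal (M.ip x y)))) := by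
    rw [← hVc, hab, hVmul, tr_mul]
    refine ((tendsto_star ((V.continuous.tendsto a).comp hua)).inner
      (tendsto_const_nhds (x := b))).congr fun n => ?_
    rw [← mul_assoc, ← hVmul, tr_mul]
    rfl
  refine (Complex.abs_re_le_norm _).trans
    (le_of_tendsto_of_tendsto' htr.norm (hux.norm.mul_const _) fun n => ?_)
  refine (M.norm_tr_mul_ip_le _ x y).trans ?_
  rw [← hVmul]
  exact mul_le_mul_of_nonneg_right (hV1 _) (norm_nonneg _)

/-! ### The covariance of a pair of tuples -/

/-- The deviations `√(p i) • (x i - mean)`, an element of the module `X ^ n`. -/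
noncomputable def deviation {n : ℕ} (p : Fin n → ℝ) (x : Fin n → X) : Fin n → X :=
  fun i => ((√(p i) : ℝ) : ℂ) • (x i - ∑ j, (p j : ℂ) • x j)

theorem pi_ip_deviation {n : ℕ} {p : Fin n → ℝ} (hp : IsProbVec p) (x y : Fin n → X) :
    (M.pi (Fin n)).ip (deviation p x) (deviation p y) =
      ∑ i, (p i : ℂ) • M.ip (x i - ∑ j, (p j : ℂ) • x j) (y i - ∑ j, (p j : ℂ) • y j) := by
  rw [pi_ip]
  refine Finset.sum_congr rfl fun i _ => ?_
  rw [deviation, deviation, ofReal_smul_ip, ip_smul, smul_smul, ← Complex.ofReal_mul,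
    Real.mul_self_sqrt (hp.1 i)]

theorem G_eq_pi_ip {n : ℕ} {p : Fin n → ℝ} (hp : IsProbVec p) (x y : Fin n → X) :
    M.G p x y = (M.pi (Fin n)).ip (deviation p x) (deviation p y) := by
  rw [M.pi_ip_deviation hp, M.sum_smul_ip_sub_mean hp.2 x y 0 0, M.G_eq_sum_sub hp.2 x y 0 0]

theorem norm_absVal_deviation_le {n : ℕ} {p : Fin n → ℝ} (hp : IsProbVec p) (x : Fin n → X)
    (a : X) {r : ℝ} (hr : 0 ≤ r) (hx : ∀ i, ‖M.absVal (x i - a)‖ ≤ r) :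
    ‖(M.pi (Fin n)).absVal (deviation p x)‖ ≤ r := by
  have hmem : ∀ i ∈ Finset.univ, (p i : ℂ) • M.ip (x i - a) (x i - a) ∈ traceClass A :=
    fun i _ => smul_mem_traceClass _ (M.ip_mem _ _)
  have hsum : ((M.pi (Fin n)).ip (deviation p x) (deviation p x)) +
      M.ip (∑ j, (p j : ℂ) • x j - a) (∑ j, (p j : ℂ) • x j - a) =
      ∑ i, (p i : ℂ) • M.ip (x i - a) (x i - a) := by
    rw [M.pi_ip_deviation hp, M.sum_smul_ip_sub_mean hp.2 x x a a, sub_add_cancel]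
  have htr := congrArg (fun c => (tr c).re) hsum
  rw [tr_add ((M.pi (Fin n)).ip_mem _ _) (M.ip_mem _ _)
    (by rw [hsum]; exact sum_mem_traceClass _ _ hmem), tr_sum _ _ hmem, Complex.add_re,
    ← norm_absVal_sq, ← norm_absVal_sq, Complex.re_sum] at htr
  have hle : ∑ i, (tr ((p i : ℂ) • M.ip (x i - a) (x i - a))).re ≤ r ^ 2 := by
    rw [← one_mul (r ^ 2), ← hp.2, Finset.sum_mul]
    refine Finset.sum_le_sum fun i _ => ?_
    rw [tr_smul _ (M.ip_mem _ _), Complex.re_ofReal_mul, ← norm_absVal_sq]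
    exact mul_le_mul_of_nonneg_left (pow_le_pow_left₀ (norm_nonneg _) (hx i) 2) (hp.1 i)
  rw [← sq_le_sq₀ (norm_nonneg _) hr]
  linarith [sq_nonneg ‖M.absVal (∑ j, (p j : ℂ) • x j - a)‖]

end SemiInnerProductModule

end HStar

/-- Part 1: the Grüss type inequality (with the fact that `G_p(x, y)` lies in the trace class).
Part 2: the constant `1` in front of `r s` is best possible on every module whose semi-inner
product is not identically zero, for all centres `a, b` and all radii `r, s > 0`. -/
theorem theorem5p1 {A X : Type*} [NonUnitalNormedRing A] [InnerProductSpace ℂ A]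
    [CompleteSpace A] [IsScalarTower ℂ A A] [SMulCommClass ℂ A A] [StarRing A] [StarModule ℂ A]
    [HStar.IsProperHStarAlgebra A] [AddCommGroup X] [Module ℂ X]
    (M : HStar.SemiInnerProductModule A X) :
    (∀ (n : ℕ) (p : Fin n → ℝ) (a b : X) (x y : Fin n → X) (r s : ℝ),
      HStar.IsProbVec p → 0 ≤ r → 0 ≤ s →
      (∀ i, ‖M.absVal (x i - a)‖ ≤ r) → (∀ i, ‖M.absVal (y i - b)‖ ≤ s) →
      M.G p x y ∈ HStar.traceClass A ∧ |HStar.tau (M.G p x y)| ≤ r * s) ∧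
    ((∃ e : X, M.ip e e ≠ 0) →
      ∀ (a b : X) (r s : ℝ), 0 < r → 0 < s → ∀ c : ℝ,
        (∀ (n : ℕ) (p : Fin n → ℝ) (x y : Fin n → X), HStar.IsProbVec p →
          (∀ i, ‖M.absVal (x i - a)‖ ≤ r) → (∀ i, ‖M.absVal (y i - b)‖ ≤ s) →
          |HStar.tau (M.G p x y)| ≤ c * (r * s)) →
        1 ≤ c) := by
  refine ⟨fun n p a b x y r s hp hr hs hx hy => ?_, ?_⟩
  · rw [M.G_eq_pi_ip hp]
    refine ⟨(M.pi (Fin n)).ip_mem _ _, ((M.pi (Fin n)).abs_tau_ip_le _ _).trans ?_⟩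
    exact mul_le_mul (M.norm_absVal_deviation_le hp x a hr hx)
      (M.norm_absVal_deviation_le hp y b hs hy) (norm_nonneg _) hr
  · rintro ⟨e, he⟩ a b r s hr hs c hc
    -- With `N = ‖|e|‖`, the points `a ± (r / N) e` and `b ± (s / N) e` have covariance
    -- `(r s / N²) ⟨e, e⟩ = ⟨f, f⟩` for `f = (√(r s) / N) e`, whose trace norm is `‖|f|‖² = r s`.
    have hN : 0 < ‖M.absVal e‖ := M.norm_absVal_pos he
    set N := ‖M.absVal e‖ with hNdef
    have hnorm : ∀ t : ℝ, 0 ≤ t → ‖M.absVal (((t / N : ℝ) : ℂ) • e)‖ = t := fun t ht => by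
      rw [M.norm_absVal_smul, abs_of_nonneg (by positivity), ← hNdef, div_mul_cancel₀ _ hN.ne']
    have hneg : ∀ f : X, ‖M.absVal (-f)‖ = ‖M.absVal f‖ := fun f => by
      simpa using M.norm_absVal_smul (-1) f
    have hball : ∀ (a : X) (t : ℝ), 0 ≤ t → ∀ i, ‖M.absVal
        (![a + ((t / N : ℝ) : ℂ) • e, a - ((t / N : ℝ) : ℂ) • e] i - a)‖ ≤ t := fun a t ht i => by
      fin_cases i
      · simpa using (hnorm t ht).le
      · simpa [hneg] using (hnorm t ht).le
    have hG : M.ip (((r / N : ℝ) : ℂ) • e) (((s / N : ℝ) : ℂ) • e)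
        = M.ip (((√(r * s) / N : ℝ) : ℂ) • e) (((√(r * s) / N : ℝ) : ℂ) • e) := by
      simp only [M.ofReal_smul_ip, M.ip_smul, smul_smul, ← Complex.ofReal_mul]
      rw [div_mul_div_comm, div_mul_div_comm, Real.mul_self_sqrt (by positivity)]
    have h := hc 2 ![1 / 2, 1 / 2] _ _
      ⟨fun i => by fin_cases i <;> norm_num, by norm_num [Fin.sum_univ_two]⟩
      (hball a r hr.le) (hball b s hs.le)
    rw [M.G_two_point, hG, M.tau_ip_self, hnorm _ (Real.sqrt_nonneg _),
      Real.sq_sqrt (by positivity), abs_of_nonneg (by positivity)] at h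
    exact le_of_mul_le_mul_right (by simpa using h) (mul_pos hr hs)
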